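/- Let $p$ be a prime and let $R$ be a (noetherian) regular commutative ring of characteristic $p$ which is $F$-finite, i.e. the Frobenius $F\colon R\to R$, $r\mapsto r^p$, is a finite ring map. Let $e\ge 0$. Write $F^e_*R$ for $R$ viewed as an $R$-module through $F^e$, so that $r\cdot x=r^{p^e}x$, put $D^{(e)}_R=\operatorname{End}_R(F^e_*R)$, and regard $F^e_*R$ as a left $D^{(e)}_R$-module by evaluation and $\operatorname{Hom}_R(F^e_*R,R)$ as an $R$-$D^{(e)}_R$-bimodule by post- and pre-composition. Then $F^e_*R$ is a locally free $R$-module of finite rank, and the Frobenius pullback $$F^{e*}=F^e_*R\otimes_R(-)\colon\ R\text{-mod}\longrightarrow D^{(e)}_R\text{-mod},$$ where $\delta\in D^{(e)}_R$ acts on $F^e_*R\otimes_R M$ as $\delta\otimes\mathrm{id}_M$, is an $R$-linear equivalence of categories (a Morita equivalence), with inverse functor $$T^e=\operatorname{Hom}_R(F^e_*R,R)\otimes_{D^{(e)}_R}(-)\colon\ D^{(e)}_R\text{-mod}\longrightarrow R\text{-mod}.$$ -/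

import Mathlib

open CategoryTheory
open scoped TensorProduct ModuleCat.Algebra

universe v u

noncomputable section

/-- `F^e_* R`: the ring `R`, regarded as an `R`-algebra (in particular as an `R`-module) through
the `e`-th iterate of the Frobenius, i.e. `r • x = r ^ (p ^ e) * x`. -/
def FrobeniusPushforward (R : Type u) (_p _e : ℕ) : Type u := R

namespace FrobeniusPushforward

variable (R : Type u) [CommRing R] (p e : ℕ)

instance : CommRing (FrobeniusPushforward R p e) := inferInstanceAs (CommRing R)

/-- The identity `R → F^e_* R`, as a map of rings (it is not `R`-linear). -/
def of : R ≃+* FrobeniusPushforward R p e := RingEquiv.refl R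

instance [ExpChar R p] : Algebra R (FrobeniusPushforward R p e) :=
  ((of R p e).toRingHom.comp (iterateFrobenius R p e)).toAlgebra

lemma smul_of [ExpChar R p] (r x : R) : r • of R p e x = of R p e (r ^ p ^ e * x) := rfl

end FrobeniusPushforward

variable (R : Type u) [CommRing R] (p e : ℕ) [ExpChar R p]

/-- `D^{(e)}_R = End_R (F^e_* R)`; the product is the composition of endomorphisms. -/
abbrev FrobeniusDiffOp : Type u := Module.End R (FrobeniusPushforward R p e)

/-- `Hom_R (F^e_* R, R)`. Its left `R`-module structure is by post-composition. -/
abbrev FrobeniusDual : Type u := FrobeniusPushforward R p e →ₗ[R] R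

/-- The Frobenius pullback `F^{e*} = F^e_* R ⊗_R –`, from `R`-modules to `D^{(e)}_R`-modules:
an operator `δ` acts on `F^e_* R ⊗_R M` as `δ ⊗ id`. -/
def frobeniusPullback :
    ModuleCat.{max u v} R ⥤ ModuleCat.{max u v} (FrobeniusDiffOp R p e) where
  obj M := ModuleCat.of (FrobeniusDiffOp R p e) (FrobeniusPushforward R p e ⊗[R] M)
  map f := ModuleCat.ofHom (TensorProduct.AlgebraTensorModule.map
    (LinearMap.id : FrobeniusPushforward R p e →ₗ[FrobeniusDiffOp R p e] _) f.hom)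
  map_id M := by
    ext
    rfl
  map_comp f g := by
    ext
    rfl

/-- For a left `D^{(e)}_R`-module `N`, the `R`-submodule of `Hom_R (F^e_* R, R) ⊗_ℤ N` generated by
the elements `φ · δ ⊗ n - φ ⊗ δ n`, where the right action `φ · δ` is pre-composition. -/
def frobeniusBalancing (N : Type*) [AddCommGroup N] [Module (FrobeniusDiffOp R p e) N] :
    Submodule R (FrobeniusDual R p e ⊗[ℤ] N) :=
  Submodule.span R {t | ∃ (φ : FrobeniusDual R p e) (δ : FrobeniusDiffOp R p e) (n : N),
    t = (φ ∘ₗ δ) ⊗ₜ[ℤ] n - φ ⊗ₜ[ℤ] (δ • n)}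

/-- The tensor product `Hom_R (F^e_* R, R) ⊗_{D^{(e)}_R} N` over the noncommutative ring
`D^{(e)}_R`, with the `R`-module structure coming from `Hom_R (F^e_* R, R)`. -/
abbrev FrobeniusDescentObj (N : Type*) [AddCommGroup N] [Module (FrobeniusDiffOp R p e) N] :=
  (FrobeniusDual R p e ⊗[ℤ] N) ⧸ frobeniusBalancing R p e N

/-- The map `id ⊗ g` on `Hom_R (F^e_* R, R) ⊗_{D^{(e)}_R} –`. -/
def frobeniusDescentMap {N N' : Type*} [AddCommGroup N] [Module (FrobeniusDiffOp R p e) N]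
    [AddCommGroup N'] [Module (FrobeniusDiffOp R p e) N'] (g : N →ₗ[FrobeniusDiffOp R p e] N') :
    FrobeniusDescentObj R p e N →ₗ[R] FrobeniusDescentObj R p e N' :=
  Submodule.mapQ _ _
    (TensorProduct.AlgebraTensorModule.map (LinearMap.id : FrobeniusDual R p e →ₗ[R] _)
      g.toAddMonoidHom.toIntLinearMap)
    (by
      rw [frobeniusBalancing, Submodule.span_le]
      rintro _ ⟨φ, δ, n, rfl⟩
      refine Submodule.subset_span ⟨φ, δ, g n, ?_⟩
      simp)

/-- The functor `T^e = Hom_R (F^e_* R, R) ⊗_{D^{(e)}_R} –` from `D^{(e)}_R`-modules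
to `R`-modules. -/
def frobeniusDescent :
    ModuleCat.{max u v} (FrobeniusDiffOp R p e) ⥤ ModuleCat.{max u v} R where
  obj N := ModuleCat.of R (FrobeniusDescentObj R p e N)
  map g := ModuleCat.ofHom (frobeniusDescentMap R p e g.hom)
  map_id N := by
    ext
    rfl
  map_comp f g := by
    ext
    rfl

end

/-- A module is locally free of finite rank if `Spec R` is covered by basic open sets `D(f)` over
which it is free of finite rank. -/
def IsLocallyFreeOfFiniteRank (R M : Type*) [CommRing R] [AddCommGroup M] [Module R M] : Prop :=
  ∀ P : PrimeSpectrum R, ∃ f ∉ P.asIdeal,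
    Module.Free (Localization.Away f) (LocalizedModule (Submonoid.powers f) M) ∧
    Module.Finite (Localization.Away f) (LocalizedModule (Submonoid.powers f) M)

/-! Local freeness is the easy half of Kunz's theorem. The maximal ideal of a regular local ring is
generated by a regular sequence. An element `r` acts on `F^e_* R` as `r ^ p ^ e`, and powers of a
regular sequence are again regular, so the same sequence is regular on `F^e_* R`. A finite module
with this property is free: divide out the sequence one element at a time, down to the residue
field. Frobenius pushforward commutes with localization, so `F^e_* R` is finite projective over any
`F`-finite regular `R`.

The rest is Morita theory. Projectivity gives a dual basis `x i`, `φ i`, and expanding `1` in it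
shows that the values of the `φ i` generate the unit ideal (`exists_sum_dual_apply_eq_one`). These
two facts invert the evaluation maps `φ ⊗ x ⊗ m ↦ φ x • m` and `x ⊗ φ ⊗ n ↦ (φ(-) x) n`, which are
the natural isomorphisms of the equivalence. -/

/-! ### Weakly regular sequences and freeness -/

section RegularSequences

open RingTheory.Sequence Pointwise

/-- Weak regularity of a sequence passes to extensions of modules. -/
lemma RingTheory.Sequence.IsWeaklyRegular.of_exact {R : Type*} [CommRing R] (rs : List R) :
    ∀ {A B C : Type u} [AddCommGroup A] [Module R A] [AddCommGroup B] [Module R B]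
      [AddCommGroup C] [Module R C] {f : A →ₗ[R] B} {g : B →ₗ[R] C},
      Function.Injective f → Function.Exact f g → Function.Surjective g →
      IsWeaklyRegular A rs → IsWeaklyRegular C rs → IsWeaklyRegular B rs := by
  induction rs with
  | nil => intros; exact .nil _ _
  | cons r rs ih =>
    intro A B C _ _ _ _ _ _ f g hf hfg hg hA hC
    rw [isWeaklyRegular_cons_iff] at hA hC ⊢
    refine ⟨isSMulRegular_of_range_eq_ker hf hfg.linearMap_ker_eq.symm hA.1 hC.1,
      ih (f := QuotSMulTop.map r f) (g := QuotSMulTop.map r g) ?_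
        (QuotSMulTop.map_exact r hfg hg) (QuotSMulTop.map_surjective r hg) hA.2 hC.2⟩
    -- Reduction mod `r` keeps `f` injective because `r` is regular on `C`; the four-term statement
    -- is used with zero as its first map.
    have h0 : Function.Exact (0 : PUnit.{u + 1} →ₗ[R] A) f := by
      rw [LinearMap.exact_zero_iff_injective]
      exact hf
    have h1 := QuotSMulTop.map_first_exact_on_four_term_exact_of_isSMulRegular_last
      (r := r) h0 hfg hC.1
    rwa [map_zero, LinearMap.exact_zero_iff_injective] at h1

/-- Multiplication by `a` gives an exact sequence `0 → M/bM → M/abM → M/aM → 0`; regularity of `a`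
is what makes it exact on the left. -/
lemma RingTheory.Sequence.IsWeaklyRegular.quotSMulTop_mul {R : Type*} [CommRing R] {M : Type u}
    [AddCommGroup M] [Module R M] {a b : R} {rs : List R} (ha : IsSMulRegular M a)
    (h₁ : IsWeaklyRegular (QuotSMulTop a M) rs) (h₂ : IsWeaklyRegular (QuotSMulTop b M) rs) :
    IsWeaklyRegular (QuotSMulTop (a * b) M) rs := by
  let f : QuotSMulTop b M →ₗ[R] QuotSMulTop (a * b) M :=
    Submodule.mapQ _ _ (LinearMap.lsmul R M a) (by
      rintro _ ⟨y, -, rfl⟩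
      exact ⟨y, trivial, by simp [mul_smul, smul_comm a b]⟩)
  let g : QuotSMulTop (a * b) M →ₗ[R] QuotSMulTop a M :=
    Submodule.mapQ _ _ LinearMap.id (by
      rintro _ ⟨y, -, rfl⟩
      exact ⟨b • y, trivial, by simp [mul_smul, smul_comm a b]⟩)
  refine .of_exact rs (f := f) (g := g) ?_ ?_ ?_ h₂ h₁
  · rw [injective_iff_map_eq_zero]
    intro x hx
    obtain ⟨x, rfl⟩ := Submodule.Quotient.mk_surjective _ x
    obtain ⟨y, -, hy⟩ := (Submodule.Quotient.mk_eq_zero _).mp hx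
    refine (Submodule.Quotient.mk_eq_zero _).mpr ⟨y, trivial, ha ?_⟩
    simpa [mul_smul] using hy
  · intro x
    obtain ⟨x, rfl⟩ := Submodule.Quotient.mk_surjective _ x
    constructor
    · intro hx
      obtain ⟨y, -, hy⟩ := (Submodule.Quotient.mk_eq_zero _).mp hx
      exact ⟨Submodule.Quotient.mk y, congrArg Submodule.Quotient.mk hy⟩
    · rintro ⟨y, hy⟩
      obtain ⟨y, rfl⟩ := Submodule.Quotient.mk_surjective _ y
      rw [← hy]
      exact (Submodule.Quotient.mk_eq_zero _).mpr ⟨y, trivial, rfl⟩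
  · intro x
    obtain ⟨x, rfl⟩ := Submodule.Quotient.mk_surjective _ x
    exact ⟨Submodule.Quotient.mk x, rfl⟩

/-- The tail is raised to powers on `M/rM` first. Then `M/r^(n+1)M` is filtered by copies of `M/rM`,
so the powered tail stays weakly regular there. -/
lemma RingTheory.Sequence.IsWeaklyRegular.map_pow {R : Type*} [CommRing R] (k : ℕ)
    (rs : List R) : ∀ {M : Type u} [AddCommGroup M] [Module R M],
      IsWeaklyRegular M rs → IsWeaklyRegular M (rs.map (· ^ (k + 1))) := by
  induction rs with
  | nil => intros; exact .nil _ _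
  | cons r rs ih =>
    intro M _ _ h
    rw [isWeaklyRegular_cons_iff] at h
    rw [List.map_cons, isWeaklyRegular_cons_iff]
    refine ⟨h.1.pow _, ?_⟩
    have h2 := ih h.2
    clear ih
    suffices ∀ n, IsWeaklyRegular (QuotSMulTop (r ^ (n + 1)) M) (rs.map (· ^ (k + 1))) from this k
    intro n
    induction n with
    | zero => rwa [zero_add, pow_one]
    | succ n ihn =>
      rw [pow_succ]
      exact .quotSMulTop_mul (h.1.pow _) ihn h2

open IsLocalRing in
/-- A finite module over a noetherian local ring is free if the maximal ideal is generated by a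
sequence which is weakly regular on the module. -/
theorem Module.Free.of_isWeaklyRegular_of_ofList_eq_maximalIdeal (n : ℕ) :
    ∀ {R M : Type u} [CommRing R] [IsLocalRing R] [IsNoetherianRing R] [AddCommGroup M]
      [Module R M] [Module.Finite R M] (rs : List R), rs.length = n →
      Ideal.ofList rs = maximalIdeal R → IsWeaklyRegular M rs → Module.Free R M := by
  induction n with
  | zero =>
    intro R M _ _ _ _ _ _ rs hn hrs _
    obtain rfl := List.length_eq_zero_iff.mp hn
    rw [Ideal.ofList_nil] at hrs
    let := (isField_iff_maximalIdeal_eq.mpr hrs.symm).toField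
    exact Module.Free.of_divisionRing R M
  | succ n ih =>
    intro R M _ _ _ _ _ _ rs hn hrs h
    obtain _ | ⟨r, rs⟩ := rs
    · simp at hn
    rw [isWeaklyRegular_cons_iff'] at h
    have hr : r ∈ maximalIdeal R := by
      rw [← hrs, Ideal.ofList_cons]
      exact Ideal.mem_sup_left (Ideal.mem_span_singleton_self r)
    have : Nontrivial (R ⧸ Ideal.span {r}) := Ideal.Quotient.nontrivial_iff.mpr fun h ↦
      Ideal.IsPrime.ne_top' (top_le_iff.mp
        (h.ge.trans ((Ideal.span_singleton_le_iff_mem _).mpr hr)) : maximalIdeal R = ⊤)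
    have : IsLocalRing (R ⧸ Ideal.span {r}) :=
      .of_surjective' (Ideal.Quotient.mk _) Ideal.Quotient.mk_surjective
    have : Module.FinitePresentation R M := Module.finitePresentation_of_finite R M
    -- Freeness lifts from `M/rM`, since `r` is `M`-regular and lies in the Jacobson radical.
    rw [← Module.free_quotSMulTop_iff_free R M (maximalIdeal_le_jacobson _ hr) h.1]
    have := Module.Finite.of_restrictScalars_finite R (R ⧸ Ideal.span {r}) (QuotSMulTop r M)
    refine ih (rs.map (Ideal.Quotient.mk (Ideal.span {r}))) (by simpa using hn) ?_ h.2
    have hm : (maximalIdeal R).map (Ideal.Quotient.mk (Ideal.span {r})) =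
        maximalIdeal (R ⧸ Ideal.span {r}) :=
      map_maximalIdeal_of_surjective _ Ideal.Quotient.mk_surjective
    rw [← Ideal.map_ofList, ← hm, ← hrs, Ideal.ofList_cons, Ideal.map_sup,
      Ideal.map_quotient_self, bot_sup_eq]

end RegularSequences

/-! ### Regular local rings -/

section RegularLocalRings

open IsLocalRing RingTheory.Sequence Pointwise

/-- If a surjection `π` from a noetherian local ring kills an element of `𝔪 \ 𝔪²`, then it lowers
the minimal number of generators of the maximal ideal. -/
lemma IsLocalRing.spanFinrank_maximalIdeal_lt_of_surjective {R S : Type*} [CommRing R]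
    [IsLocalRing R] [IsNoetherianRing R] [CommRing S] [IsLocalRing S] (π : R →+* S)
    (hπ : Function.Surjective π) {x : R} (hx : x ∈ maximalIdeal R) (hx2 : x ∉ maximalIdeal R ^ 2)
    (hπx : π x = 0) : (maximalIdeal S).spanFinrank < (maximalIdeal R).spanFinrank := by
  classical
  obtain ⟨s, hs, hspan⟩ := Submodule.FG.exists_span_finset_card_eq_spanFinrank
    (IsNoetherian.noetherian (maximalIdeal R))
  rw [← hs]
  have hx' : x ∈ Submodule.span R (s : Set R) := hspan ▸ hx
  obtain ⟨a, -, ha⟩ := Submodule.mem_span_finset.mp hx'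
  -- If no coefficient were a unit, `x` would lie in `𝔪²`. The relation `π x = 0` then makes the
  -- generator `π y` redundant.
  obtain ⟨y, hys, hy⟩ : ∃ y ∈ s, IsUnit (a y) := by
    by_contra! h
    refine hx2 (ha ▸ Ideal.sum_mem _ fun y hy ↦ ?_)
    rw [pow_two, smul_eq_mul]
    refine Ideal.mul_mem_mul ((mem_maximalIdeal _).mpr (h y hy)) ?_
    rw [← hspan]
    exact Submodule.subset_span hy
  have hπy : π y ∈ Ideal.span (Set.image π (s.erase y : Finset R)) := by
    have h0 : ∑ z ∈ s, π (a z) * π z = 0 := by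
      rw [← hπx, ← ha, map_sum]
      simp only [smul_eq_mul, map_mul]
    rw [← Finset.add_sum_erase _ _ hys] at h0
    have h1 : π (a y) * π y ∈ Ideal.span (Set.image π (s.erase y : Finset R)) := by
      rw [eq_neg_of_add_eq_zero_left h0]
      exact neg_mem (Ideal.sum_mem _ fun z hz ↦ Ideal.mul_mem_left _ _
        (Ideal.subset_span ⟨z, hz, rfl⟩))
    exact (Ideal.unit_mul_mem_iff_mem _ (hy.map π)).mp h1
  have hgen : maximalIdeal S = Submodule.span S (((s.erase y).image π : Finset S) : Set S) := by
    have hmap : maximalIdeal S = Ideal.span (Set.image π s) := by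
      rw [← map_maximalIdeal_of_surjective π hπ, ← Ideal.map_span]
      exact congrArg (Ideal.map π) hspan.symm
    rw [hmap, Finset.coe_image]
    refine le_antisymm (Ideal.span_le.mpr ?_)
      (Ideal.span_mono (Set.image_mono (Finset.coe_subset.mpr (Finset.erase_subset _ _))))
    rintro _ ⟨z, hz, rfl⟩
    by_cases hzy : z = y
    · exact hzy ▸ hπy
    · exact Ideal.subset_span ⟨z, Finset.mem_erase.mpr ⟨hzy, hz⟩, rfl⟩
  rw [hgen]
  refine (Submodule.spanFinrank_span_le_ncard_of_finite (Finset.finite_toSet _)).trans_lt ?_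
  rw [Set.ncard_coe_finset]
  exact Finset.card_image_le.trans_lt (Finset.card_erase_lt_of_mem hys)

/-- A noetherian local ring is a domain if a quotient by some `x ∈ 𝔪` outside all minimal primes
is a domain. -/
lemma IsLocalRing.isDomain_of_isPrime_span_singleton {R : Type*} [CommRing R] [IsLocalRing R]
    [IsNoetherianRing R] {x : R} (hmin : ∀ P ∈ minimalPrimes R, x ∉ P)
    [hp : (Ideal.span {x}).IsPrime] : IsDomain R := by
  obtain ⟨P, hP, hPx⟩ := Ideal.exists_minimalPrimes_le (bot_le (a := Ideal.span {x}))
  have : P.IsPrime := hP.1.1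
  have hP0 : P = ⊥ := by
    -- Each element of `P` is `z * x` with `x ∉ P`, so `z ∈ P`. Hence `P = xP`, and Nakayama gives
    -- `P = 0`.
    refine Submodule.eq_bot_of_le_smul_of_le_jacobson_bot (Ideal.span {x}) P
      (IsNoetherian.noetherian P) (fun y hy ↦ ?_)
      ((le_maximalIdeal hp.ne_top).trans (maximalIdeal_le_jacobson _))
    obtain ⟨z, rfl⟩ := Ideal.mem_span_singleton'.mp (hPx hy)
    rw [mul_comm]
    exact Submodule.smul_mem_smul (Ideal.mem_span_singleton_self x)
      ((this.mem_or_mem hy).resolve_right (hmin P hP))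
  exact IsDomain.of_bot_isPrime R (hbp := hP0 ▸ this)

/-- A regular local ring is a domain, and its maximal ideal is generated by a regular sequence. -/
theorem IsRegularLocalRing.isDomain_and_exists_isWeaklyRegular (n : ℕ) :
    ∀ (R : Type u) [CommRing R] [IsRegularLocalRing R], (maximalIdeal R).spanFinrank = n →
      IsDomain R ∧ ∃ rs : List R, IsWeaklyRegular R rs ∧ Ideal.ofList rs = maximalIdeal R := by
  induction n with
  | zero =>
    intro R _ _ hn
    have hbot : maximalIdeal R = ⊥ :=
      (Submodule.spanFinrank_eq_zero_iff_eq_bot (IsNoetherian.noetherian _)).mp hn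
    exact ⟨(isField_iff_maximalIdeal_eq.mpr hbot).isDomain, [], .nil _ _, by simp [hbot]⟩
  | succ n ih =>
    intro R _ _ hn
    have hdim : ringKrullDim R = (n + 1 : ℕ) := by
      rw [← hn, IsRegularLocalRing.spanFinrank_maximalIdeal]
    -- Prime avoidance, with `𝔪²` as the permitted non-prime ideal. Positive dimension excludes both
    -- `𝔪 ⊆ 𝔪²` and `𝔪` being a minimal prime.
    obtain ⟨x, hx, hx2, hmin⟩ : ∃ x ∈ maximalIdeal R, x ∉ maximalIdeal R ^ 2 ∧
        ∀ P ∈ minimalPrimes R, x ∉ P := by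
      classical
      by_contra! h
      have hfin := minimalPrimes.finite_of_isNoetherianRing R
      have hsub : (maximalIdeal R : Set R) ⊆
          ⋃ I ∈ (↑(insert (maximalIdeal R ^ 2) hfin.toFinset) : Set (Ideal R)), (I : Set R) := by
        intro x hx
        by_cases hx2 : x ∈ maximalIdeal R ^ 2
        · exact Set.mem_biUnion (by simp) hx2
        · obtain ⟨P, hP, hxP⟩ := h x hx hx2
          exact Set.mem_biUnion (by simp [hP]) hxP
      obtain ⟨I, hI, hle⟩ := (Ideal.subset_union_prime (f := id) (maximalIdeal R ^ 2)
        (maximalIdeal R ^ 2) (fun I hI h _ ↦ by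
          have : I ∈ minimalPrimes R := by simpa [h] using hI
          exact this.1.1)).mp hsub
      rw [Finset.mem_insert, hfin.mem_toFinset] at hI
      rcases hI with rfl | hI
      · exact (maximalIdeal_sq_lt_maximalIdeal R).mpr
          (fun hfield ↦ by
            rw [ringKrullDim_eq_zero_of_isField hfield] at hdim
            exact n.succ_ne_zero (by exact_mod_cast hdim.symm)) |>.not_ge hle
      · have := hI.1.1
        have hIm : I = maximalIdeal R := le_antisymm (le_maximalIdeal this.ne_top) hle
        have h0 := maximalIdeal_height_eq_ringKrullDim (R := R)
        rw [← hIm, Ideal.height_eq_zero_iff.mpr hI, hdim] at h0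
        exact n.succ_ne_zero (by exact_mod_cast h0.symm)
    have : Nontrivial (R ⧸ Ideal.span {x}) := Ideal.Quotient.nontrivial_iff.mpr fun h ↦
      Ideal.IsPrime.ne_top' (top_le_iff.mp
        (h.ge.trans ((Ideal.span_singleton_le_iff_mem _).mpr hx)) : maximalIdeal R = ⊤)
    have : IsLocalRing (R ⧸ Ideal.span {x}) :=
      .of_surjective' (Ideal.Quotient.mk _) Ideal.Quotient.mk_surjective
    -- Modulo `x` the number of generators drops by at least one and the dimension by at most one,
    -- so the quotient is regular of dimension `n`.
    have hle : (maximalIdeal (R ⧸ Ideal.span {x})).spanFinrank ≤ n := by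
      have := spanFinrank_maximalIdeal_lt_of_surjective
        (Ideal.Quotient.mk (Ideal.span {x})) Ideal.Quotient.mk_surjective hx hx2
        (Ideal.Quotient.eq_zero_iff_mem.mpr (Ideal.mem_span_singleton_self x))
      omega
    have hge : (n : WithBot ℕ∞) ≤ ringKrullDim (R ⧸ Ideal.span {x}) := by
      have h := ringKrullDim_le_ringKrullDim_quotSMulTop_succ hx
      rw [hdim, ← Submodule.ideal_span_singleton_smul, smul_eq_mul, Ideal.mul_top] at h
      push_cast at h
      exact ENat.WithBot.add_le_add_one_right_iff.mp h
    have hreg : IsRegularLocalRing (R ⧸ Ideal.span {x}) :=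
      .of_spanFinrank_maximalIdeal_le _ (le_trans (by exact_mod_cast hle) hge)
    have heq : (maximalIdeal (R ⧸ Ideal.span {x})).spanFinrank = n := by
      refine le_antisymm hle ?_
      rw [← hreg.spanFinrank_maximalIdeal] at hge
      exact_mod_cast hge
    obtain ⟨hdom, rs, hrs, hrs'⟩ := ih _ heq
    have : (Ideal.span {x}).IsPrime := (Ideal.Quotient.isDomain_iff_prime _).mp hdom
    have hR : IsDomain R := isDomain_of_isPrime_span_singleton hmin
    refine ⟨hR, ?_⟩
    obtain ⟨rs, rfl⟩ := (List.map_surjective_iff.mpr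
      (Ideal.Quotient.mk_surjective (I := Ideal.span {x}))) rs
    have hx0 : x ≠ 0 := fun h ↦ hx2 (h ▸ zero_mem _)
    have htop : x • (⊤ : Submodule R R) = Ideal.span {x} := by
      rw [← Submodule.ideal_span_singleton_smul, smul_eq_mul, Ideal.mul_top]
    refine ⟨x :: rs, .cons (IsSMulRegular.of_ne_zero hx0) ?_, ?_⟩
    · rw [(Submodule.quotEquivOfEq _ _ htop).isWeaklyRegular_congr,
        ← isWeaklyRegular_map_algebraMap_iff (R ⧸ Ideal.span {x})]
      exact hrs
    · have hker : Ideal.span {x} ≤ maximalIdeal R :=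
        (Ideal.span_singleton_le_iff_mem _).mpr hx
      have hc := congrArg (Ideal.comap (Ideal.Quotient.mk (Ideal.span {x}))) hrs'
      rw [← Ideal.map_ofList, ← map_maximalIdeal_of_surjective _
        (Ideal.Quotient.mk_surjective (I := Ideal.span {x})),
        Ideal.comap_map_of_surjective' _ Ideal.Quotient.mk_surjective,
        Ideal.comap_map_of_surjective' _ Ideal.Quotient.mk_surjective, Ideal.mk_ker,
        sup_eq_left.mpr hker] at hc
      rw [Ideal.ofList_cons, sup_comm, hc]

end RegularLocalRings

/-! ### Freeness and projectivity of the Frobenius pushforward -/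

section FrobeniusPushforward

open RingTheory.Sequence

namespace FrobeniusPushforward

lemma finite (R : Type u) [CommRing R] (p e : ℕ) [ExpChar R p] (hF : (frobenius R p).Finite) :
    Module.Finite R (FrobeniusPushforward R p e) := by
  have h : ∀ n, (iterateFrobenius R p n).Finite := by
    intro n
    induction n with
    | zero =>
      rw [iterateFrobenius_zero]
      exact RingHom.Finite.id R
    | succ n ih =>
      have : iterateFrobenius R p (n + 1) = (iterateFrobenius R p n).comp (frobenius R p) := by
        ext x
        simp [iterateFrobenius_def, frobenius_def, pow_succ', pow_mul]
      rw [this]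
      exact ih.comp hF
  have h' : ((of R p e).toRingHom.comp (iterateFrobenius R p e)).Finite :=
    (RingHom.Finite.of_surjective _ (of R p e).surjective).comp (h e)
  exact h'

/-- Over a regular local ring, a finite Frobenius pushforward is free. -/
theorem free_of_isRegularLocalRing (R : Type u) [CommRing R] [IsRegularLocalRing R] (p e : ℕ)
    [ExpChar R p] [Module.Finite R (FrobeniusPushforward R p e)] :
    Module.Free R (FrobeniusPushforward R p e) := by
  obtain ⟨-, rs, hrs, hrs'⟩ :=
    IsRegularLocalRing.isDomain_and_exists_isWeaklyRegular _ R rfl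
  refine .of_isWeaklyRegular_of_ofList_eq_maximalIdeal _ rs rfl hrs' ?_
  obtain ⟨k, hk⟩ : ∃ k, p ^ e = k + 1 :=
    Nat.exists_eq_succ_of_ne_zero (pow_ne_zero _ (expChar_pos R p).ne')
  -- Under the identity map, `r` acting on `F^e_* R` corresponds to `r ^ p ^ e` acting on `R`.
  refine ((of R p e).symm.toAddEquiv.isWeaklyRegular_congr
    (bs := rs.map (· ^ (k + 1))) ?_).mpr (hrs.map_pow k)
  rw [List.forall₂_map_right_iff, List.forall₂_same]
  intro r _ x
  obtain ⟨x, rfl⟩ := (of R p e).surjective x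
  rw [smul_of, hk]
  rfl

section Localization

variable {R S : Type*} [CommRing R] [CommRing S] [Algebra R S] (p e : ℕ)
  [ExpChar S p] [Module R (FrobeniusPushforward S p e)]
  [IsScalarTower R S (FrobeniusPushforward S p e)]

lemma algebraMap_smul_of (r : R) (x : S) :
    r • of S p e x = of S p e (algebraMap R S r ^ p ^ e * x) := by
  rw [← smul_of, algebraMap_smul]

variable [ExpChar R p]

/-- The map `F^e_* R → F^e_* S` induced by the structure map of an `R`-algebra `S`. -/
noncomputable def mapAlgebraMap :
    FrobeniusPushforward R p e →ₗ[R] FrobeniusPushforward S p e where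
  toFun x := of S p e (algebraMap R S ((of R p e).symm x))
  map_add' x y := by simp
  map_smul' r x := by
    obtain ⟨x, rfl⟩ := (of R p e).surjective x
    rw [smul_of, RingHom.id_apply, algebraMap_smul_of]
    simp

lemma mapAlgebraMap_of (x : R) :
    (mapAlgebraMap p e (of R p e x) : FrobeniusPushforward S p e) = of S p e (algebraMap R S x) :=
  rfl

/-- With `p ^ e = k + 1`, the fraction `a / s` equals `s ^ k * a / s ^ (k + 1)`, so denominators
that are `p ^ e`-th powers suffice. -/
lemma isLocalizedModule_mapAlgebraMap (T : Submonoid R) [IsLocalization T S] :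
    IsLocalizedModule T
      (mapAlgebraMap p e : FrobeniusPushforward R p e →ₗ[R] FrobeniusPushforward S p e) where
  map_units s := by
    rw [Module.End.isUnit_iff]
    convert MulAction.bijective (α := Sˣ) (β := FrobeniusPushforward S p e)
      (IsLocalization.map_units S s).unit using 1
    ext x
    simp [Units.smul_def]
  surj y := by
    obtain ⟨y, rfl⟩ := (of S p e).surjective y
    obtain ⟨a, s, rfl⟩ := IsLocalization.exists_mk'_eq T y
    obtain ⟨k, hk⟩ : ∃ k, p ^ e = k + 1 :=
      Nat.exists_eq_succ_of_ne_zero (pow_ne_zero _ (expChar_pos R p).ne')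
    refine ⟨(of R p e ((s : R) ^ k * a), s), ?_⟩
    rw [mapAlgebraMap_of, Submonoid.smul_def, algebraMap_smul_of, hk, pow_succ, mul_assoc,
      IsLocalization.mk'_spec', map_mul (algebraMap R S), map_pow (algebraMap R S)]
  exists_of_eq {x y} h := by
    obtain ⟨x, rfl⟩ := (of R p e).surjective x
    obtain ⟨y, rfl⟩ := (of R p e).surjective y
    obtain ⟨c, hc⟩ := IsLocalization.exists_of_eq (M := T) ((of S p e).injective h)
    obtain ⟨k, hk⟩ : ∃ k, p ^ e = k + 1 :=
      Nat.exists_eq_succ_of_ne_zero (pow_ne_zero _ (expChar_pos R p).ne')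
    refine ⟨c, ?_⟩
    rw [RingEquiv.symm_apply_apply, RingEquiv.symm_apply_apply] at hc
    rw [Submonoid.smul_def, Submonoid.smul_def, smul_of, smul_of, hk, pow_succ, mul_assoc,
      mul_assoc, hc]

end Localization

/-- The Frobenius pushforward of an `F`-finite regular ring is free at every prime. -/
theorem mem_freeLocus (R : Type u) [CommRing R] [IsRegularRing R] (p e : ℕ) [Fact p.Prime]
    [CharP R p] (hF : (frobenius R p).Finite) (P : PrimeSpectrum R) :
    P ∈ Module.freeLocus R (FrobeniusPushforward R p e) := by
  let S := Localization.AtPrime P.asIdeal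
  have hp0 : (p : S) = 0 := by
    rw [← map_natCast (algebraMap R S), CharP.cast_eq_zero, map_zero]
  have hS : CharP S p := by
    rw [← CharP.ringChar_of_prime_eq_zero Fact.out hp0]
    exact ringChar.charP S
  let : Module R (FrobeniusPushforward S p e) := Module.compHom _ (algebraMap R S)
  have : IsScalarTower R S (FrobeniusPushforward S p e) := .of_algebraMap_smul fun _ _ ↦ rfl
  have := isLocalizedModule_mapAlgebraMap (S := S) p e P.asIdeal.primeCompl
  rw [Module.mem_freeLocus_of_isLocalization P S (FrobeniusPushforward S p e)
    (mapAlgebraMap p e)]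
  have := finite R p e hF
  have : Module.Finite S (FrobeniusPushforward S p e) :=
    Module.Finite.of_isLocalizedModule P.asIdeal.primeCompl (mapAlgebraMap p e)
  exact free_of_isRegularLocalRing S p e

/-- The Frobenius pushforward of an `F`-finite regular ring is a projective module. -/
theorem projective (R : Type u) [CommRing R] [IsRegularRing R] (p e : ℕ) [Fact p.Prime]
    [CharP R p] (hF : (frobenius R p).Finite) :
    Module.Projective R (FrobeniusPushforward R p e) := by
  have := finite R p e hF
  have := Module.finitePresentation_of_finite R (FrobeniusPushforward R p e)
  exact Module.freeLocus_eq_univ_iff.mp (Set.eq_univ_of_forall (mem_freeLocus R p e hF))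

/-- Finite presentation spreads freeness from a stalk to a basic open neighbourhood. -/
theorem isLocallyFreeOfFiniteRank (R : Type u) [CommRing R] [IsRegularRing R] (p e : ℕ)
    [Fact p.Prime] [CharP R p] (hF : (frobenius R p).Finite) :
    IsLocallyFreeOfFiniteRank R (FrobeniusPushforward R p e) := by
  intro P
  have := finite R p e hF
  have := Module.finitePresentation_of_finite R (FrobeniusPushforward R p e)
  have : Module.Free (Localization.AtPrime P.asIdeal)
      (LocalizedModule P.asIdeal.primeCompl (FrobeniusPushforward R p e)) :=
    mem_freeLocus R p e hF P
  obtain ⟨f, hf, hfree, -⟩ := Module.FinitePresentation.exists_free_localizedModule_powers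
    P.asIdeal.primeCompl
    (LocalizedModule.mkLinearMap P.asIdeal.primeCompl (FrobeniusPushforward R p e))
    (Localization.AtPrime P.asIdeal)
  exact ⟨f, hf, hfree, Module.Finite.of_isLocalizedModule (Submonoid.powers f)
    (LocalizedModule.mkLinearMap (Submonoid.powers f) (FrobeniusPushforward R p e))⟩

/-- The functionals of a dual basis of `F^e_* R` generate the unit ideal. -/
theorem exists_sum_dual_apply_eq_one (R : Type u) [CommRing R] (p e : ℕ) [ExpChar R p]
    {n : ℕ} (x : Fin n → FrobeniusPushforward R p e) (φ : Fin n → FrobeniusDual R p e)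
    (hφ : ∀ y, ∑ i, φ i y • x i = y) :
    ∃ y : Fin n → FrobeniusPushforward R p e, ∑ i, φ i (y i) = 1 := by
  let I : Ideal R := Ideal.span (Set.range fun i ↦ φ i (of R p e 1))
  have hI : I = ⊤ := by
    by_contra hI
    obtain ⟨m, hm, hIm⟩ := Ideal.exists_le_maximal I hI
    -- Otherwise every `φ i 1` lies in `m`, and so does `1 = ∑ (φ i 1) ^ p ^ e * x i`, the exponent
    -- being positive.
    have h1 : (of R p e).symm (∑ i, φ i (of R p e 1) • x i) ∈ m := by
      rw [map_sum]
      refine Ideal.sum_mem _ fun i _ ↦ ?_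
      obtain ⟨z, hz⟩ := (of R p e).surjective (x i)
      rw [← hz, smul_of, RingEquiv.symm_apply_apply]
      exact Ideal.mul_mem_right _ _ (Ideal.pow_mem_of_mem _
        (hIm (Ideal.subset_span ⟨i, rfl⟩)) _ (Nat.pos_of_ne_zero
          (pow_ne_zero _ (expChar_pos R p).ne')))
    rw [hφ, RingEquiv.symm_apply_apply] at h1
    exact hm.ne_top ((Ideal.eq_top_iff_one _).mpr h1)
  obtain ⟨c, hc⟩ := Ideal.mem_span_range_iff_exists_fun.mp ((Ideal.eq_top_iff_one I).mp hI)
  exact ⟨fun i ↦ c i • of R p e 1, by simpa using hc⟩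

end FrobeniusPushforward

end FrobeniusPushforward

/-! ### The Morita equivalence -/

section Morita

variable {R : Type u} [CommRing R] {p e : ℕ} [ExpChar R p]

/-- The class of `φ ⊗ n` in `Hom_R (F^e_* R, R) ⊗_{D^{(e)}_R} N`. -/
def descentTmul {N : Type*} [AddCommGroup N] [Module (FrobeniusDiffOp R p e) N]
    (φ : FrobeniusDual R p e) (n : N) : FrobeniusDescentObj R p e N :=
  Submodule.Quotient.mk (φ ⊗ₜ[ℤ] n)

section DescentTmul

variable {N : Type*} [AddCommGroup N] [Module (FrobeniusDiffOp R p e) N]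

lemma descentTmul_zero (φ : FrobeniusDual R p e) : descentTmul φ (0 : N) = 0 := by
  simp [descentTmul]

lemma descentTmul_add (φ : FrobeniusDual R p e) (n n' : N) :
    descentTmul φ (n + n') = descentTmul φ n + descentTmul φ n' := by
  simp [descentTmul, TensorProduct.tmul_add]

lemma smul_descentTmul (r : R) (φ : FrobeniusDual R p e) (n : N) :
    r • descentTmul φ n = descentTmul (r • φ) n :=
  rfl

lemma sum_smul_descentTmul {ι : Type*} (s : Finset ι) (r : ι → R) (φ : FrobeniusDual R p e)
    (n : N) : ∑ i ∈ s, descentTmul (r i • φ) n = (∑ i ∈ s, r i) • descentTmul φ n := by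
  simp_rw [← smul_descentTmul, Finset.sum_smul]

lemma descentTmul_smul (φ : FrobeniusDual R p e) (δ : FrobeniusDiffOp R p e) (n : N) :
    descentTmul φ (δ • n) = descentTmul (φ ∘ₗ δ) n :=
  Eq.symm <| (Submodule.Quotient.eq (frobeniusBalancing R p e N)).mpr <|
    Submodule.subset_span ⟨φ, δ, n, rfl⟩

lemma frobeniusDescentMap_descentTmul {N' : Type*} [AddCommGroup N']
    [Module (FrobeniusDiffOp R p e) N'] (g : N →ₗ[FrobeniusDiffOp R p e] N')
    (φ : FrobeniusDual R p e) (n : N) :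
    frobeniusDescentMap R p e g (descentTmul φ n) = descentTmul φ (g n) :=
  rfl

@[elab_as_elim]
lemma FrobeniusDescentObj.induction_on {motive : FrobeniusDescentObj R p e N → Prop}
    (t : FrobeniusDescentObj R p e N) (zero : motive 0)
    (tmul : ∀ φ n, motive (descentTmul φ n))
    (add : ∀ x y, motive x → motive y → motive (x + y)) : motive t := by
  obtain ⟨t, rfl⟩ := Submodule.Quotient.mk_surjective _ t
  induction t using TensorProduct.induction_on with
  | zero => exact zero
  | tmul φ n => exact tmul φ n
  | add x y hx hy => exact add _ _ hx hy

end DescentTmul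

section Unit

variable (R p e) (M : Type*) [AddCommGroup M] [Module R M]

/-- The evaluation `Hom_R (F^e_* R, R) ⊗_{D^{(e)}_R} (F^e_* R ⊗_R M) → M`. -/
noncomputable def descentPullbackEval :
    FrobeniusDescentObj R p e (FrobeniusPushforward R p e ⊗[R] M) →ₗ[R] M :=
  Submodule.liftQ _
    (TensorProduct.AlgebraTensorModule.lift
      { toFun φ := ((TensorProduct.lid R M).toLinearMap ∘ₗ φ.rTensor M).restrictScalars ℤ
        map_add' φ ψ := by
          ext t
          simp [LinearMap.rTensor_add]
        map_smul' r φ := by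
          ext t
          simp [LinearMap.rTensor_smul] })
    (by
      rw [frobeniusBalancing, Submodule.span_le]
      rintro _ ⟨φ, δ, t, rfl⟩
      induction t using TensorProduct.induction_on with
      | zero => simp
      | tmul x m => simp [TensorProduct.smul_tmul']
      | add x y hx hy =>
        rw [SetLike.mem_coe] at hx hy ⊢
        convert add_mem hx hy using 1
        simp only [smul_add, TensorProduct.tmul_add]
        abel)

variable {R p e M}

lemma descentPullbackEval_descentTmul (φ : FrobeniusDual R p e) (x : FrobeniusPushforward R p e)
    (m : M) : descentPullbackEval R p e M (descentTmul φ (x ⊗ₜ[R] m)) = φ x • m := by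
  simp [descentPullbackEval, descentTmul]

/-- The inverse is `m ↦ ∑ φ i ⊗ y i ⊗ m`. The rank-one operator `ψ(-) y i` sends `x ⊗ m` to `y i ⊗ ψ
x • m`; moved across the balanced tensor it turns `φ i` into `φ i (y i) • ψ`, and these coefficients
sum to `1`. -/
lemma descentPullbackEval_bijective {n : ℕ} (φ : Fin n → FrobeniusDual R p e)
    (y : Fin n → FrobeniusPushforward R p e) (h : ∑ i, φ i (y i) = 1) :
    Function.Bijective (descentPullbackEval R p e M) := by
  have key (t) : ∑ i, descentTmul (φ i) (y i ⊗ₜ[R] descentPullbackEval R p e M t) = t := by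
    induction t using FrobeniusDescentObj.induction_on with
    | zero => simp [descentTmul_zero]
    | add s t hs ht =>
      simp only [map_add, TensorProduct.tmul_add, descentTmul_add, Finset.sum_add_distrib, hs, ht]
    | tmul ψ t =>
      induction t using TensorProduct.induction_on with
      | zero => simp [descentTmul_zero]
      | add s t hs ht =>
        simp only [map_add, TensorProduct.tmul_add, descentTmul_add, Finset.sum_add_distrib,
          hs, ht]
      | tmul x m =>
        have hi (i) : descentTmul (φ i) (y i ⊗ₜ[R] (ψ x • m)) =
            descentTmul (φ i (y i) • ψ) (x ⊗ₜ[R] m) := by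
          have h1 : y i ⊗ₜ[R] (ψ x • m) =
              (ψ.smulRight (y i) : FrobeniusDiffOp R p e) • (x ⊗ₜ[R] m) := by
            rw [TensorProduct.smul_tmul', TensorProduct.tmul_smul, TensorProduct.smul_tmul']
            rfl
          rw [h1, descentTmul_smul]
          congr 1
          ext z
          simp [mul_comm]
        simp_rw [descentPullbackEval_descentTmul, hi, sum_smul_descentTmul, h, one_smul]
  refine ⟨fun s t hst ↦ ?_, fun m ↦ ⟨∑ i, descentTmul (φ i) (y i ⊗ₜ[R] m), ?_⟩⟩
  · rw [← key s, ← key t, hst]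
  · simp_rw [map_sum, descentPullbackEval_descentTmul, ← Finset.sum_smul, h, one_smul]

lemma descentPullbackEval_naturality {M' : Type*} [AddCommGroup M'] [Module R M']
    (f : M →ₗ[R] M')
    (t : FrobeniusDescentObj R p e (FrobeniusPushforward R p e ⊗[R] M)) :
    descentPullbackEval R p e M' (frobeniusDescentMap R p e (TensorProduct.AlgebraTensorModule.map
      (LinearMap.id : FrobeniusPushforward R p e →ₗ[FrobeniusDiffOp R p e] _) f) t) =
      f (descentPullbackEval R p e M t) := by
  induction t using FrobeniusDescentObj.induction_on with
  | zero => simp only [map_zero]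
  | add s t hs ht => simp only [map_add, hs, ht]
  | tmul ψ t =>
    rw [frobeniusDescentMap_descentTmul]
    induction t using TensorProduct.induction_on with
    | zero => simp only [descentTmul_zero, map_zero]
    | add s t hs ht => simp only [map_add, descentTmul_add, hs, ht]
    | tmul z m =>
      rw [TensorProduct.AlgebraTensorModule.map_tmul, descentPullbackEval_descentTmul,
        descentPullbackEval_descentTmul, map_smul, LinearMap.id_apply]

end Unit

section Counit

variable (R p e) (N : Type*) [AddCommGroup N] [Module (FrobeniusDiffOp R p e) N] [Module R N]
  [IsScalarTower R (FrobeniusDiffOp R p e) N]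

/-- For `x ∈ F^e_* R`, the map `φ ⊗ n ↦ (φ(-) x) n`. -/
noncomputable def descentAct (x : FrobeniusPushforward R p e) :
    FrobeniusDescentObj R p e N →ₗ[R] N :=
  Submodule.liftQ _
    (TensorProduct.AlgebraTensorModule.lift
      { toFun φ := (DistribSMul.toAddMonoidHom N
          (φ.smulRight x : FrobeniusDiffOp R p e)).toIntLinearMap
        map_add' φ ψ := by
          ext n
          have : (φ + ψ).smulRight x = φ.smulRight x + ψ.smulRight x := by
            ext z
            simp [add_smul]
          simp [this, add_smul]
        map_smul' r φ := by
          ext n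
          have : (r • φ).smulRight x = r • φ.smulRight x := by
            ext z
            simp [mul_smul]
          simp [this] })
    (by
      rw [frobeniusBalancing, Submodule.span_le]
      rintro _ ⟨φ, δ, n, rfl⟩
      have : (φ ∘ₗ δ).smulRight x = (φ.smulRight x : FrobeniusDiffOp R p e) * δ := rfl
      simp [this, mul_smul])

variable {N} in
lemma descentAct_descentTmul (x : FrobeniusPushforward R p e) (φ : FrobeniusDual R p e) (n : N) :
    descentAct R p e N x (descentTmul φ n) = (φ.smulRight x : FrobeniusDiffOp R p e) • n := by
  simp [descentAct, descentTmul]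

/-- The `R`-bilinear map `(x, φ ⊗ n) ↦ (φ(-) x) n`. -/
noncomputable def descentActBilin :
    FrobeniusPushforward R p e →ₗ[R] FrobeniusDescentObj R p e N →ₗ[R] N where
  toFun := descentAct R p e N
  map_add' x y := by
    refine LinearMap.ext fun t ↦ ?_
    induction t using FrobeniusDescentObj.induction_on with
    | zero => simp
    | tmul φ n =>
      have : φ.smulRight (x + y) = φ.smulRight x + φ.smulRight y := by
        ext z
        simp
      simp [descentAct_descentTmul, this, add_smul]
    | add s t hs ht => rw [map_add, hs, ht, map_add]
  map_smul' r x := by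
    refine LinearMap.ext fun t ↦ ?_
    induction t using FrobeniusDescentObj.induction_on with
    | zero => simp
    | tmul φ n =>
      have : φ.smulRight (r • x) = r • φ.smulRight x := by
        ext z
        simp [smul_comm r]
      simp [descentAct_descentTmul, this]
    | add s t hs ht => rw [map_add, hs, ht, map_add]

variable {N} in
lemma descentActBilin_smul_apply (δ : FrobeniusDiffOp R p e) (x : FrobeniusPushforward R p e)
    (t : FrobeniusDescentObj R p e N) :
    descentActBilin R p e N (δ • x) t = δ • descentActBilin R p e N x t := by
  change descentAct R p e N (δ • x) t = δ • descentAct R p e N x t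
  induction t using FrobeniusDescentObj.induction_on with
  | zero => rw [map_zero, map_zero, smul_zero]
  | tmul φ n =>
    have : φ.smulRight (δ • x) = δ * (φ.smulRight x : FrobeniusDiffOp R p e) := by
      ext z
      simp
    rw [descentAct_descentTmul, descentAct_descentTmul, this, mul_smul]
  | add s t hs ht => rw [map_add, hs, ht, map_add, smul_add]

/-- The map `F^e_* R ⊗_R (Hom_R (F^e_* R, R) ⊗_{D^{(e)}_R} N) → N`,
`x ⊗ φ ⊗ n ↦ (φ(-) x) n`. -/
noncomputable def pullbackDescentEval :
    FrobeniusPushforward R p e ⊗[R] FrobeniusDescentObj R p e N →ₗ[FrobeniusDiffOp R p e] N :=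
  TensorProduct.AlgebraTensorModule.lift
    { toFun := descentActBilin R p e N
      map_add' := map_add _
      map_smul' := fun δ x ↦ LinearMap.ext fun t ↦ descentActBilin_smul_apply R p e δ x t }

variable {R p e N}

lemma pullbackDescentEval_tmul (x : FrobeniusPushforward R p e) (φ : FrobeniusDual R p e)
    (n : N) : pullbackDescentEval R p e N (x ⊗ₜ[R] descentTmul φ n) =
      (φ.smulRight x : FrobeniusDiffOp R p e) • n :=
  descentAct_descentTmul R p e x φ n

/-- The inverse is `m ↦ ∑ x i ⊗ φ i ⊗ m`. Moving `ψ(-) z` across the balanced tensor turns `φ i`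
into `φ i z • ψ`; the scalar passes to `x i`, and the dual basis sums to `z`. -/
lemma pullbackDescentEval_bijective {n : ℕ} (x : Fin n → FrobeniusPushforward R p e)
    (φ : Fin n → FrobeniusDual R p e) (h : ∀ y, ∑ i, φ i y • x i = y) :
    Function.Bijective (pullbackDescentEval R p e N) := by
  have key (t) : ∑ i, x i ⊗ₜ[R] descentTmul (φ i) (pullbackDescentEval R p e N t) = t := by
    induction t using TensorProduct.induction_on with
    | zero => simp [descentTmul_zero]
    | add s t hs ht =>
      simp only [map_add, TensorProduct.tmul_add, descentTmul_add, Finset.sum_add_distrib, hs, ht]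
    | tmul z t =>
      induction t using FrobeniusDescentObj.induction_on with
      | zero => simp [descentTmul_zero]
      | add s t hs ht =>
        simp only [map_add, TensorProduct.tmul_add, descentTmul_add, Finset.sum_add_distrib,
          hs, ht]
      | tmul ψ m =>
        have hi (i) : x i ⊗ₜ[R] descentTmul (φ i)
            ((ψ.smulRight z : FrobeniusDiffOp R p e) • m) =
            (φ i z • x i) ⊗ₜ[R] descentTmul ψ m := by
          rw [descentTmul_smul, TensorProduct.smul_tmul, smul_descentTmul]
          congr 2
          ext w
          simp [mul_comm]
        simp_rw [pullbackDescentEval_tmul, hi, ← TensorProduct.sum_tmul, h]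
  refine ⟨fun s t hst ↦ ?_, fun m ↦ ⟨∑ i, x i ⊗ₜ[R] descentTmul (φ i) m, ?_⟩⟩
  · rw [← key s, ← key t, hst]
  · simp_rw [map_sum, pullbackDescentEval_tmul, ← Finset.sum_smul]
    have : ∑ i, (φ i).smulRight (x i) = (1 : FrobeniusDiffOp R p e) := by
      ext z
      simp [h]
    rw [this, one_smul]

lemma pullbackDescentEval_naturality {N' : Type*} [AddCommGroup N']
    [Module (FrobeniusDiffOp R p e) N'] [Module R N'] [IsScalarTower R (FrobeniusDiffOp R p e) N']
    (g : N →ₗ[FrobeniusDiffOp R p e] N')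
    (t : FrobeniusPushforward R p e ⊗[R] FrobeniusDescentObj R p e N) :
    pullbackDescentEval R p e N' (TensorProduct.AlgebraTensorModule.map
      (LinearMap.id : FrobeniusPushforward R p e →ₗ[FrobeniusDiffOp R p e] _)
      (frobeniusDescentMap R p e g) t) = g (pullbackDescentEval R p e N t) := by
  induction t using TensorProduct.induction_on with
  | zero => simp only [map_zero]
  | add s t hs ht => simp only [map_add, hs, ht]
  | tmul z t =>
    induction t using FrobeniusDescentObj.induction_on with
    | zero => simp only [TensorProduct.tmul_zero, map_zero]
    | add s t hs ht => simp only [TensorProduct.tmul_add, map_add, hs, ht]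
    | tmul ψ m =>
      rw [TensorProduct.AlgebraTensorModule.map_tmul, frobeniusDescentMap_descentTmul,
        pullbackDescentEval_tmul, pullbackDescentEval_tmul, map_smul, LinearMap.id_apply]

end Counit

section Equivalence

variable (R p e)

/-- If `F^e_* R` has a finite dual basis whose functionals generate the unit ideal, then the
Frobenius pullback is an equivalence of categories, with inverse `T^e`. -/
noncomputable def frobeniusEquivalence {n : ℕ} (x y : Fin n → FrobeniusPushforward R p e)
    (φ : Fin n → FrobeniusDual R p e) (hx : ∀ z, ∑ i, φ i z • x i = z)
    (hy : ∑ i, φ i (y i) = 1) :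
    ModuleCat.{max u v} R ≌ ModuleCat.{max u v} (FrobeniusDiffOp R p e) :=
  -- No triangle identity has to be checked: `Equivalence.mk` adjusts one of the isomorphisms and
  -- keeps both functors as given.
  CategoryTheory.Equivalence.mk (frobeniusPullback.{v} R p e) (frobeniusDescent.{v} R p e)
    (NatIso.ofComponents (F := frobeniusPullback.{v} R p e ⋙ frobeniusDescent.{v} R p e)
      (G := 𝟭 _)
      (fun M ↦ (LinearEquiv.ofBijective (descentPullbackEval R p e M)
        (descentPullbackEval_bijective φ y hy)).toModuleIso)
      (fun f ↦ ModuleCat.hom_ext (LinearMap.ext fun t ↦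
        descentPullbackEval_naturality f.hom t))).symm
    (NatIso.ofComponents (F := frobeniusDescent.{v} R p e ⋙ frobeniusPullback.{v} R p e)
      (G := 𝟭 _)
      (fun N ↦ (LinearEquiv.ofBijective (pullbackDescentEval R p e N)
        (pullbackDescentEval_bijective x φ hx)).toModuleIso)
      (fun f ↦ ModuleCat.hom_ext (LinearMap.ext fun t ↦
        pullbackDescentEval_naturality f.hom t)))

lemma frobeniusPullback_linear : (frobeniusPullback.{v} R p e).Linear R where
  map_smul f r := by
    refine ModuleCat.hom_ext (LinearMap.ext fun t ↦ ?_)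
    induction t using TensorProduct.induction_on with
    | zero => exact (map_zero _).trans (map_zero _).symm
    | add s t hs ht => exact (map_add _ s t).trans ((congrArg₂ _ hs ht).trans (map_add _ s t).symm)
    | tmul x m => exact TensorProduct.tmul_smul r x (f.hom m)

end Equivalence

end Morita

theorem mainTheorem4 (R : Type u) [CommRing R] [IsRegularRing R] (p : ℕ) [Fact p.Prime]
    [CharP R p] (hF : (frobenius R p).Finite) (e : ℕ) :
    IsLocallyFreeOfFiniteRank R (FrobeniusPushforward R p e) ∧
    ∃ E : ModuleCat.{max u v} R ≌ ModuleCat.{max u v} (FrobeniusDiffOp R p e),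
      E.functor = frobeniusPullback.{v} R p e ∧
      E.inverse = frobeniusDescent.{v} R p e ∧
      E.functor.Linear R := by
  refine ⟨FrobeniusPushforward.isLocallyFreeOfFiniteRank R p e hF, ?_⟩
  have := FrobeniusPushforward.finite R p e hF
  have := FrobeniusPushforward.projective R p e hF
  obtain ⟨n, f, g, -, -, hfg⟩ :=
    Module.Finite.exists_comp_eq_id_of_projective R (FrobeniusPushforward R p e)
  -- The splitting `f ∘ g = id` through `R^n` yields the dual basis: images of the unit vectors, and
  -- coordinates of `g`.
  let x (i : Fin n) : FrobeniusPushforward R p e := f (Pi.single i 1)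
  let φ (i : Fin n) : FrobeniusDual R p e := LinearMap.proj i ∘ₗ g
  have hx (z) : ∑ i, φ i z • x i = z := by
    conv_rhs => rw [← LinearMap.id_apply (R := R) z, ← hfg, LinearMap.comp_apply,
      ← LinearMap.sum_single_apply (fun _ ↦ R) (g z), map_sum]
    refine Finset.sum_congr rfl fun i _ ↦ ?_
    rw [← map_smul, ← Pi.single_smul, smul_eq_mul, mul_one]
    rfl
  obtain ⟨y, hy⟩ := FrobeniusPushforward.exists_sum_dual_apply_eq_one R p e x φ hx
  exact ⟨frobeniusEquivalence.{v} R p e x y φ hx hy, rfl, rfl, frobeniusPullback_linear R p e⟩
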